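/- Fix integers $k_1,k_2,k_3,d\ge 0$. For every $n$ let $p=p_n$ and consider (non-random) parameters $\alpha\in\mathbb R^n$, $Z=(Z_1\ Z_2\ Z_3)\in\mathbb R^{n\times(k_1+k_2+k_3)}$, $\Lambda=(\Lambda_2\ \Lambda_3)\in\mathbb R^{p\times(k_2+k_3)}$ and a diagonal matrix $\Psi\in\mathbb R^{p\times p}$, all of which may depend on $n$. Put $Z_{12}=(Z_1\ Z_2)$ and $P=\alpha 1_n^T+1_n\alpha^T+Z_{12}Z_{12}^T$. Assume that the following hold for all sufficiently large $n$: (a) all entries $P_{ij}$ lie in $[0,1]$, and $A\in\{0,1\}^{n\times n}$ is a random symmetric matrix with zero diagonal whose entries $A_{ij}$, $i<j$, are independent with $A_{ij}\sim\mathrm{Bernoulli}(P_{ij})$; (b) $P$ is positive semidefinite and $\max_{1\le i\le n}\sum_{j=1}^nP_{ij}>(\log n)^{4+a}$, for some constant $a>0$ independent of $n$; (c) $0<\Psi_{jj}\le C$ and $\|\lambda_j\|_2\le C$ for all $1\le j\le p$, where $\lambda_j$ is the $j$-th row of $\Lambda$, and the entries of $\lim_n Z^TZ/n$, if this limit exists,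 are at most $C$ in absolute value, for some constant $C>0$ independent of $n$; (d) the columns of $Z$ sum to zero, and one of the following holds: (1) $Z_{12}^TZ_3=0$, $\Lambda_2^T\Psi^{-1}\Lambda_2/p$ is diagonal with distinct diagonal elements, and $\Lambda_3$ contains the identity matrix $I_{k_3}$ as a submatrix; (2) $Z^TZ$ is diagonal with distinct diagonal elements and $\Lambda_3^T\Psi^{-1}\Lambda_3/p=I_{k_3}$; (3) $Z_{12}^TZ_3=0$, $Z_{12}^TZ_{12}$ has distinct eigenvalues, $Z_3^TZ_3$ is diagonal with distinct diagonal elements, $\Lambda_2$ is lower triangular and $\Lambda_3^T\Psi^{-1}\Lambda_3/p=I_{k_3}$. Let $X\in\mathbb R^{n\times d}$, with rows $x_1^T,\dots,x_n^T$, satisfy $P=XX^T$ for all sufficiently large $n$, and assume that $\overline M_X=\lim_{n\to\infty}X^TX/n$ exists. Let $\hat\alpha=n^{-1}(I-P_1/2)A1_n$, where $P_1=n^{-1}1_n1_n^T$. Then for each fixed $i$ for which the limit $\tilde Q_i=\lim_{n\to\infty}n^{-1}\sum_{j\ne i}x_i^Tx_j(1-x_i^Tx_j)$ exists, we have $\tilde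 Q_i\ge 0$ and, as $n\to\infty$, $$\sqrt n\,(\hat\alpha_i-\alpha_i)\ \longrightarrow\ \mathcal N(0,\tilde Q_i)\quad\text{in distribution},$$ where $\mathcal N(0,0)$ denotes the point mass at $0$. -/

import Mathlib

open MeasureTheory ProbabilityTheory Filter Topology Matrix

noncomputable section

/-- The (non-random) parameters of the generalized factor model with `n` observations and `p`
variables.  The columns of `Z = (Z₁ Z₂ Z₃)` are indexed by `(Fin k₁ ⊕ Fin k₂) ⊕ Fin k₃`, those of
`Λ = (Λ₂ Λ₃)` by `Fin k₂ ⊕ Fin k₃`; `Ψ` is the diagonal of the (diagonal) noise covariance. -/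
structure GFParams (n p k₁ k₂ k₃ : ℕ) where
  α : Fin n → ℝ
  Z : Matrix (Fin n) ((Fin k₁ ⊕ Fin k₂) ⊕ Fin k₃) ℝ
  Λ : Matrix (Fin p) (Fin k₂ ⊕ Fin k₃) ℝ
  Ψ : Fin p → ℝ

/-- The `i`-th entry (counted from `0`) of a vector of length `n`, with the value `0` if the vector
has no such entry.  It allows to fix `i` and let `n → ∞`. -/
def entry {n : ℕ} (v : Fin n → ℝ) (i : ℕ) : ℝ :=
  if h : i < n then v ⟨i, h⟩ else 0

/-- `M` is diagonal, with pairwise distinct diagonal entries. -/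
def IsDiagDistinct {m : Type*} (M : Matrix m m ℝ) : Prop :=
  M.IsDiag ∧ Function.Injective M.diag

/-- Every column of `M` sums to zero. -/
def IsCentered {n : ℕ} {m : Type*} (M : Matrix (Fin n) m ℝ) : Prop :=
  ∀ l, ∑ i, M i l = 0

namespace GFParams

variable {n p k₁ k₂ k₃ : ℕ}

def Z12 (θ : GFParams n p k₁ k₂ k₃) : Matrix (Fin n) (Fin k₁ ⊕ Fin k₂) ℝ := θ.Z.toCols₁

def Z3 (θ : GFParams n p k₁ k₂ k₃) : Matrix (Fin n) (Fin k₃) ℝ := θ.Z.toCols₂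

def Λ2 (θ : GFParams n p k₁ k₂ k₃) : Matrix (Fin p) (Fin k₂) ℝ := θ.Λ.toCols₁

def Λ3 (θ : GFParams n p k₁ k₂ k₃) : Matrix (Fin p) (Fin k₃) ℝ := θ.Λ.toCols₂

/-- `P = α 1ᵀ + 1 αᵀ + Z₁₂ Z₁₂ᵀ`. -/
def P (θ : GFParams n p k₁ k₂ k₃) : Matrix (Fin n) (Fin n) ℝ :=
  vecMulVec θ.α 1 + vecMulVec 1 θ.α + θ.Z12 * θ.Z12ᵀ

/-- First set of identifiability conditions. -/
def Ident1 (θ : GFParams n p k₁ k₂ k₃) : Prop :=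
  IsCentered θ.Z ∧ θ.Z12ᵀ * θ.Z3 = 0 ∧
    IsDiagDistinct ((p : ℝ)⁻¹ • (θ.Λ2ᵀ * (diagonal θ.Ψ)⁻¹ * θ.Λ2)) ∧
    ∃ r : Fin k₃ → Fin p, θ.Λ3.submatrix r id = 1

/-- Second set of identifiability conditions. -/
def Ident2 (θ : GFParams n p k₁ k₂ k₃) : Prop :=
  IsCentered θ.Z ∧ IsDiagDistinct (θ.Zᵀ * θ.Z) ∧
    (p : ℝ)⁻¹ • (θ.Λ3ᵀ * (diagonal θ.Ψ)⁻¹ * θ.Λ3) = 1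

/-- Third set of identifiability conditions.  A real symmetric matrix has distinct eigenvalues iff
its characteristic polynomial has no repeated real root. -/
def Ident3 (θ : GFParams n p k₁ k₂ k₃) : Prop :=
  IsCentered θ.Z ∧ θ.Z12ᵀ * θ.Z3 = 0 ∧
    (θ.Z12ᵀ * θ.Z12).charpoly.roots.Nodup ∧ IsDiagDistinct (θ.Z3ᵀ * θ.Z3) ∧
    (∀ (j : Fin p) (l : Fin k₂), (j : ℕ) < (l : ℕ) → θ.Λ2 j l = 0) ∧
    (p : ℝ)⁻¹ • (θ.Λ3ᵀ * (diagonal θ.Ψ)⁻¹ * θ.Λ3) = 1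

end GFParams

/-- The random matrix `A` has independent Bernoulli edges with probability matrix `P`
(all of whose entries lie in `[0, 1]`): it is symmetric with zero diagonal, and its entries above
the diagonal are independent with `A i j ∼ Bernoulli (P i j)`. -/
structure IsBernoulliNetwork {Ω : Type*} [MeasurableSpace Ω] (μ : Measure Ω) {n : ℕ}
    (A : Ω → Matrix (Fin n) (Fin n) ℝ) (P : Matrix (Fin n) (Fin n) ℝ) : Prop where
  mem_unit : ∀ i j, P i j ∈ unitInterval
  symm_zero_diag : ∀ᵐ ω ∂μ, (A ω).IsSymm ∧ ∀ i, A ω i i = 0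
  indep : iIndepFun (fun (e : {e : Fin n × Fin n // e.1 < e.2}) (ω : Ω) ↦ A ω e.1.1 e.1.2) μ
  law : ∀ i j, i < j →
    HasLaw (fun ω ↦ A ω i j) (bernoulliMeasure (1 : ℝ) 0 ⟨P i j, mem_unit i j⟩) μ

/-- The projection matrix onto the span of the all-ones vector, `1 1ᵀ / n`. -/
def onesProj (n : ℕ) : Matrix (Fin n) (Fin n) ℝ :=
  (n : ℝ)⁻¹ • vecMulVec 1 1

/-- `α̂ = n⁻¹ (I - P₁ / 2) A 1`. -/
def alphaHat {n : ℕ} (A : Matrix (Fin n) (Fin n) ℝ) : Fin n → ℝ :=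
  (n : ℝ)⁻¹ • (((1 : Matrix (Fin n) (Fin n) ℝ) - (2 : ℝ)⁻¹ • onesProj n) * A) *ᵥ 1

/-- The vector with `i`-th entry `n⁻¹ ∑_{j ≠ i} xᵢᵀxⱼ (1 - xᵢᵀxⱼ)`, `xᵢ` the `i`-th row of `X`. -/
def edgeVariance {n d : ℕ} (X : Matrix (Fin n) (Fin d) ℝ) : Fin n → ℝ := fun i ↦
  (n : ℝ)⁻¹ * ∑ j ∈ Finset.univ.erase i, (X i ⬝ᵥ X j) * (1 - X i ⬝ᵥ X j)

end

/-! Because the columns of `Z` are centred, `α` is the image of `P` under the same linear map that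
sends `A` to `α̂`. Hence `√n (α̂ᵢ - αᵢ)` is linear in `A - P`. Folding `(k, j)` with `(j, k)` makes
it a weighted sum of independent centred Bernoulli variables, one per edge, plus a deterministic
diagonal bias of order `n^(-1/2)` (`sqrt_mul_alphaHat_sub`).

Edges at `i` have weight about `n^(-1/2)`, all others `n^(-3/2)` in absolute value. The latter are
too light to matter, so the variance tends to `Q` (`abs_alphaHatVariance_sub_le`). As every weight
is at most `n^(-1/2)`, a Lindeberg-type comparison of characteristic functions has error at most
`|t| n^(-1/2)` times `t²` times the variance. Lévy's continuity theorem concludes. Nothing is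
divided by the variance, so `Q = 0` is no exception. -/

/-! ### Characteristic functions of weighted Bernoulli sums -/

/-- Products of complex numbers in the closed unit disc differ by at most the sum of the
differences of the factors. -/
theorem norm_prod_sub_prod_le_sum {ι : Type*} (s : Finset ι) (f g : ι → ℂ)
    (hf : ∀ i, ‖f i‖ ≤ 1) (hg : ∀ i, ‖g i‖ ≤ 1) :
    ‖∏ i ∈ s, f i - ∏ i ∈ s, g i‖ ≤ ∑ i ∈ s, ‖f i - g i‖ := by
  classical
  induction s using Finset.induction_on with
  | empty => simp
  | insert a s ha ih =>
    rw [Finset.prod_insert ha, Finset.prod_insert ha, Finset.sum_insert ha]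
    have hs : ‖∏ i ∈ s, f i‖ ≤ 1 :=
      (Finset.norm_prod_le _ _).trans (Finset.prod_le_one (fun i _ ↦ norm_nonneg _) fun i _ ↦ hf i)
    calc ‖f a * ∏ i ∈ s, f i - g a * ∏ i ∈ s, g i‖
        = ‖(f a - g a) * ∏ i ∈ s, f i + g a * (∏ i ∈ s, f i - ∏ i ∈ s, g i)‖ := by
          congr 1; ring
      _ ≤ ‖f a - g a‖ * ‖∏ i ∈ s, f i‖ + ‖g a‖ * ‖∏ i ∈ s, f i - ∏ i ∈ s, g i‖ := by
          rw [← norm_mul, ← norm_mul]; exact norm_add_le _ _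
      _ ≤ ‖f a - g a‖ * 1 + 1 * ‖∏ i ∈ s, f i - ∏ i ∈ s, g i‖ := by
          gcongr
          exact hg a
      _ ≤ _ := by linarith

theorem Complex.norm_exp_ofReal_mul_I_sub_taylor_le {x : ℝ} (hx : |x| ≤ 1) :
    ‖Complex.exp (x * Complex.I) - (1 + x * Complex.I - x ^ 2 / 2)‖ ≤ |x| ^ 3 / 4 := by
  have hn : ‖(x : ℂ) * Complex.I‖ = |x| := by simp
  have h := Complex.exp_bound (x := x * Complex.I) (by rwa [hn]) (n := 3) (by norm_num)
  rw [hn] at h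
  have e : ∑ m ∈ Finset.range 3, ((x : ℂ) * Complex.I) ^ m / m.factorial
      = 1 + x * Complex.I - x ^ 2 / 2 := by
    simp [Finset.sum_range_succ, mul_pow, Nat.factorial]
    ring
  rw [e] at h
  -- The third-order bound has constant `4 / (3! * 3) = 2/9`, rounded up to `1/4`.
  refine h.trans ?_
  have : 0 ≤ |x| ^ 3 := by positivity
  norm_num [Nat.factorial]
  linarith

/-- The characteristic function at `s` of a centred Bernoulli variable with parameter `q`. -/
noncomputable def centeredBernoulliCharFun (q s : ℝ) : ℂ :=
  q * Complex.exp ((s * (1 - q) : ℝ) * Complex.I) +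
    (1 - q) * Complex.exp ((s * (0 - q) : ℝ) * Complex.I)

theorem norm_centeredBernoulliCharFun_le_one {q : ℝ} (h0 : 0 ≤ q) (h1 : q ≤ 1) (s : ℝ) :
    ‖centeredBernoulliCharFun q s‖ ≤ 1 := by
  refine (norm_add_le _ _).trans ?_
  rw [norm_mul, norm_mul, Complex.norm_exp_ofReal_mul_I, Complex.norm_exp_ofReal_mul_I,
    ← Complex.ofReal_one, ← Complex.ofReal_sub, Complex.norm_real, Complex.norm_real,
    Real.norm_of_nonneg h0, Real.norm_of_nonneg (by linarith)]
  linarith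

/-- Mean and variance agree, so the expansions match to second order. The error keeps the factor `q
(1 - q)`, so that summing over edges produces the total variance and not the number of edges. -/
theorem norm_centeredBernoulliCharFun_sub_exp_le {q s : ℝ} (h0 : 0 ≤ q) (h1 : q ≤ 1)
    (hs : |s| ≤ 1) :
    ‖centeredBernoulliCharFun q s - Complex.exp ((-(s ^ 2 * (q * (1 - q)) / 2) : ℝ))‖ ≤
      |s| * (s ^ 2 * (q * (1 - q))) := by
  have hv : 0 ≤ q * (1 - q) := mul_nonneg h0 (by linarith)
  have hv1 : q * (1 - q) ≤ 1 := by nlinarith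
  have hs2 : s ^ 2 ≤ 1 := by rw [← sq_abs]; exact pow_le_one₀ (abs_nonneg _) hs
  have hx : |s * (1 - q)| = |s| * (1 - q) := by rw [abs_mul, abs_of_nonneg (by linarith : 0 ≤ 1 - q)]
  have hy : |s * (0 - q)| = |s| * q := by rw [abs_mul, zero_sub, abs_neg, abs_of_nonneg h0]
  have a1 := Complex.norm_exp_ofReal_mul_I_sub_taylor_le (x := s * (1 - q))
    (by rw [hx]; nlinarith [abs_nonneg s])
  have a2 := Complex.norm_exp_ofReal_mul_I_sub_taylor_le (x := s * (0 - q))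
    (by rw [hy]; nlinarith [abs_nonneg s])
  rw [hx] at a1
  rw [hy] at a2
  set y : ℝ := -(s ^ 2 * (q * (1 - q)) / 2) with hydef
  have hyabs : ‖(y : ℂ)‖ = s ^ 2 * (q * (1 - q)) / 2 := by
    rw [Complex.norm_real, Real.norm_eq_abs, hydef, abs_neg, abs_of_nonneg (by positivity)]
  have hw : s ^ 2 * (q * (1 - q)) ≤ 1 := by nlinarith [sq_nonneg s]
  have a3 := Complex.norm_exp_sub_one_sub_id_le (x := (y : ℂ)) (by rw [hyabs]; linarith)
  rw [hyabs] at a3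
  set T1 := Complex.exp ((s * (1 - q) : ℝ) * Complex.I) -
    (1 + (s * (1 - q) : ℝ) * Complex.I - (s * (1 - q) : ℝ) ^ 2 / 2)
  set T2 := Complex.exp ((s * (0 - q) : ℝ) * Complex.I) -
    (1 + (s * (0 - q) : ℝ) * Complex.I - (s * (0 - q) : ℝ) ^ 2 / 2)
  -- The linear terms cancel, and `q (1 - q)² + (1 - q) q² = q (1 - q)` matches `y`; only the three
  -- remainders survive, each worth at most a quarter of the bound.
  have key : centeredBernoulliCharFun q s - Complex.exp (y : ℂ) =
      (q : ℝ) * T1 + (1 - q : ℝ) * T2 - (Complex.exp y - 1 - y) := by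
    simp only [centeredBernoulliCharFun, T1, T2, hydef]
    push_cast
    ring
  rw [key]
  have n1 : ‖((q : ℝ) : ℂ) * T1‖ ≤ q * ((|s| * (1 - q)) ^ 3 / 4) := by
    rw [norm_mul, Complex.norm_real, Real.norm_of_nonneg h0]; gcongr
  have n2 : ‖((1 - q : ℝ) : ℂ) * T2‖ ≤ (1 - q) * ((|s| * q) ^ 3 / 4) := by
    rw [norm_mul, Complex.norm_real, Real.norm_of_nonneg (by linarith)]
    exact mul_le_mul_of_nonneg_left a2 (by linarith)
  have b1 : q * ((|s| * (1 - q)) ^ 3 / 4) ≤ |s| * (s ^ 2 * (q * (1 - q))) / 4 := by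
    have : (1 - q) ^ 2 ≤ 1 := by nlinarith
    calc q * ((|s| * (1 - q)) ^ 3 / 4) = |s| * (|s| ^ 2 * (q * (1 - q))) / 4 * (1 - q) ^ 2 := by ring
      _ ≤ |s| * (|s| ^ 2 * (q * (1 - q))) / 4 * 1 := by gcongr
      _ = _ := by rw [sq_abs, mul_one]
  have b2 : (1 - q) * ((|s| * q) ^ 3 / 4) ≤ |s| * (s ^ 2 * (q * (1 - q))) / 4 := by
    have : q ^ 2 ≤ 1 := by nlinarith
    calc (1 - q) * ((|s| * q) ^ 3 / 4) = |s| * (|s| ^ 2 * (q * (1 - q))) / 4 * q ^ 2 := by ring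
      _ ≤ |s| * (|s| ^ 2 * (q * (1 - q))) / 4 * 1 := by gcongr
      _ = _ := by rw [sq_abs, mul_one]
  have b3 : (s ^ 2 * (q * (1 - q)) / 2) ^ 2 ≤ |s| * (s ^ 2 * (q * (1 - q))) / 4 := by
    have : s ^ 2 * (q * (1 - q)) ≤ |s| := by
      calc s ^ 2 * (q * (1 - q)) ≤ s ^ 2 * 1 := by gcongr
        _ = |s| * |s| := by rw [mul_one, abs_mul_abs_self, sq]
        _ ≤ |s| * 1 := by gcongr
        _ = |s| := mul_one _
    calc (s ^ 2 * (q * (1 - q)) / 2) ^ 2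
        = (s ^ 2 * (q * (1 - q))) * (s ^ 2 * (q * (1 - q))) / 4 := by ring
      _ ≤ |s| * (s ^ 2 * (q * (1 - q))) / 4 := by gcongr
  have b4 : 0 ≤ |s| * (s ^ 2 * (q * (1 - q))) := by positivity
  calc _ ≤ ‖((q : ℝ) : ℂ) * T1‖ + ‖((1 - q : ℝ) : ℂ) * T2‖ + ‖Complex.exp y - 1 - y‖ :=
        (norm_sub_le _ _).trans (by gcongr; exact norm_add_le _ _)
    _ ≤ _ := by linarith

theorem charFun_map_mul_sub_of_hasLaw_bernoulli {Ω : Type*} [MeasurableSpace Ω] {μ : Measure Ω}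
    {Y : Ω → ℝ} {q : unitInterval} (hY : HasLaw Y (bernoulliMeasure (1 : ℝ) 0 q) μ) (c t : ℝ) :
    charFun (μ.map fun ω ↦ c * (Y ω - q)) t = centeredBernoulliCharFun q (t * c) := by
  have hm : μ.map (fun ω ↦ c * (Y ω - q)) = (μ.map Y).map fun y ↦ c * (y - q) := by
    rw [AEMeasurable.map_map_of_aemeasurable (by fun_prop) hY.aemeasurable]
    rfl
  rw [hm, hY.map_eq, map_bernoulliMeasure, charFun_apply_real, integral_bernoulliMeasure]
  simp [centeredBernoulliCharFun, mul_assoc]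

/-- The characteristic function of a shifted weighted sum of independent centred Bernoulli
variables is close to the Gaussian one when all weights are small. -/
theorem norm_charFun_bernoulli_sum_sub_exp_le {Ω ι : Type*} [MeasurableSpace Ω] [Fintype ι]
    {μ : Measure Ω} [IsProbabilityMeasure μ] {Y : ι → Ω → ℝ} {q : ι → unitInterval}
    (hind : iIndepFun Y μ) (hY : ∀ e, HasLaw (Y e) (bernoulliMeasure (1 : ℝ) 0 (q e)) μ)
    (c : ι → ℝ) (b t ε : ℝ) (hε : ε ≤ 1) (hc : ∀ e, |t * c e| ≤ ε) :
    ‖charFun (μ.map fun ω ↦ ∑ e, c e * (Y e ω - q e) + b) t -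
        Complex.exp ((-(t ^ 2 * ∑ e, c e ^ 2 * (q e * (1 - q e)) ) / 2 : ℝ)) *
          Complex.exp ((b * t : ℝ) * Complex.I)‖ ≤
      ε * (t ^ 2 * ∑ e, c e ^ 2 * (q e * (1 - q e))) := by
  have hYm : ∀ e, AEMeasurable (Y e) μ := fun e ↦ (hY e).aemeasurable
  have hm : μ.map (fun ω ↦ ∑ e, c e * (Y e ω - q e) + b) =
      (μ.map (fun ω ↦ ∑ e, c e * (Y e ω - q e))).map (· + b) := by
    rw [AEMeasurable.map_map_of_aemeasurable (by fun_prop) (by fun_prop)]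
    rfl
  have hind' : iIndepFun (fun e ω ↦ c e * (Y e ω - q e)) μ :=
    hind.comp (fun e y ↦ c e * (y - q e)) fun e ↦ by fun_prop
  have hin : (inner ℝ b t : ℝ) = b * t := by simp [mul_comm]
  -- The shift `b` multiplies both sides by the same unimodular factor, which drops out of the norm.
  rw [hm, charFun_map_add_const, hin,
    iIndepFun.charFun_map_fun_sum_eq_prod (fun e ↦ by fun_prop) hind', ← sub_mul, norm_mul,
    Complex.norm_exp_ofReal_mul_I, mul_one, Finset.prod_apply]
  simp_rw [charFun_map_mul_sub_of_hasLaw_bernoulli (hY _)]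
  have hexp : Complex.exp ((-(t ^ 2 * ∑ e, c e ^ 2 * (q e * (1 - q e)) ) / 2 : ℝ)) =
      ∏ e, Complex.exp ((-((t * c e) ^ 2 * (q e * (1 - q e)) / 2) : ℝ)) := by
    rw [← Complex.exp_sum, ← Complex.ofReal_sum]
    congr 2
    rw [Finset.mul_sum, neg_div, Finset.sum_div, Finset.sum_neg_distrib]
    congr 1
    exact Finset.sum_congr rfl fun e _ ↦ by ring
  have hv : ∀ e, 0 ≤ (q e : ℝ) * (1 - q e) := fun e ↦
    mul_nonneg (q e).2.1 (sub_nonneg.2 (q e).2.2)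
  rw [hexp]
  refine (norm_prod_sub_prod_le_sum _ _ _
    (fun e ↦ norm_centeredBernoulliCharFun_le_one (q e).2.1 (q e).2.2 _) fun e ↦ ?_).trans ?_
  · rw [← Complex.ofReal_exp, Complex.norm_real, Real.norm_of_nonneg (Real.exp_nonneg _),
      Real.exp_le_one_iff, neg_nonpos]
    have := hv e
    positivity
  · rw [Finset.mul_sum, Finset.mul_sum]
    refine Finset.sum_le_sum fun e _ ↦ ?_
    refine (norm_centeredBernoulliCharFun_sub_exp_le (q e).2.1 (q e).2.2
      ((hc e).trans hε)).trans ?_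
    calc |t * c e| * ((t * c e) ^ 2 * (q e * (1 - q e)))
        ≤ ε * ((t * c e) ^ 2 * (q e * (1 - q e))) := by
          have := hv e
          gcongr
          exact hc e
      _ = _ := by ring

/-! ### Reduction of the estimator to a sum over edges -/

/-- A sum over all pairs splits into the pairs above, below and on the diagonal. -/
theorem sum_sum_eq_sum_edges_add_sum_diag {n : ℕ} (f : Fin n → Fin n → ℝ) :
    ∑ k, ∑ j, f k j = ∑ e : {e : Fin n × Fin n // e.1 < e.2},
      (f e.1.1 e.1.2 + f e.1.2 e.1.1) + ∑ k, f k k := by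
  have h1 : ∀ g : Fin n → Fin n → ℝ, ∑ e : {e : Fin n × Fin n // e.1 < e.2}, g e.1.1 e.1.2 =
      ∑ k, ∑ j, if k < j then g k j else 0 := by
    intro g
    rw [← Finset.sum_product', Finset.univ_product_univ, ← Finset.sum_filter]
    exact (Finset.sum_subtype (Finset.univ.filter fun e : Fin n × Fin n ↦ e.1 < e.2)
      (by simp) fun e ↦ g e.1 e.2).symm
  rw [h1 fun k j ↦ f k j + f j k]
  have h2 : ∑ k, ∑ j, (if k < j then f k j + f j k else 0) =
      ∑ k, ∑ j, ((if k < j then f k j else 0) + if j < k then f k j else 0) := by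
    have : ∀ k j : Fin n, (if k < j then f k j + f j k else 0) =
        (if k < j then f k j else 0) + if k < j then f j k else 0 := by
      intro k j; split_ifs <;> simp
    simp_rw [this, Finset.sum_add_distrib]
    congr 1
    exact Finset.sum_comm
  rw [h2, ← Finset.sum_add_distrib]
  refine Finset.sum_congr rfl fun k _ ↦ ?_
  have h3 : f k k = ∑ j, if k = j then f k j else 0 := by simp
  rw [h3, ← Finset.sum_add_distrib]
  refine Finset.sum_congr rfl fun j _ ↦ ?_
  rcases lt_trichotomy k j with h | h | h
  · simp [h, h.ne, h.not_gt]
  · simp [h]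
  · simp [h, h.ne', h.not_gt]

theorem alphaHat_apply {n : ℕ} (A : Matrix (Fin n) (Fin n) ℝ) (i : Fin n) :
    alphaHat A i = (n : ℝ)⁻¹ * ∑ k, ∑ j, ((if k = i then 1 else 0) - (2 * n : ℝ)⁻¹) * A k j := by
  simp only [alphaHat, Pi.smul_apply, smul_eq_mul, ← mulVec_mulVec]
  congr 1
  simp only [onesProj, sub_mulVec, one_mulVec, smul_mulVec, Pi.sub_apply, Pi.smul_apply,
    smul_eq_mul]
  simp only [mulVec, dotProduct, vecMulVec_apply, Pi.one_apply, mul_one, one_mul, sub_mul, ite_mul,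
    zero_mul, Finset.sum_sub_distrib, ← Finset.mul_sum, mul_inv]
  simp [mul_assoc]

theorem GFParams.sum_P_row {n p k₁ k₂ k₃ : ℕ} (θ : GFParams n p k₁ k₂ k₃)
    (hZ : IsCentered θ.Z) (k : Fin n) :
    ∑ j, θ.P k j = n * θ.α k + ∑ j, θ.α j := by
  have hc : ∑ j, (θ.Z12 * θ.Z12ᵀ) k j = 0 := by
    simp only [mul_apply, transpose_apply]
    rw [Finset.sum_comm]
    refine Finset.sum_eq_zero fun l _ ↦ ?_
    rw [← Finset.mul_sum, show ∑ j, θ.Z12 j l = 0 from hZ (Sum.inl l), mul_zero]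
  simp only [GFParams.P, Matrix.add_apply, Finset.sum_add_distrib, hc]
  simp [vecMulVec_apply]

/-- Each row sum of `P` is `n αₖ + ∑ α`, and half the average row sum is `∑ α`; subtracting it
leaves `n αᵢ`. -/
theorem GFParams.sum_weighted_P {n p k₁ k₂ k₃ : ℕ} (θ : GFParams n p k₁ k₂ k₃)
    (hZ : IsCentered θ.Z) (i : Fin n) :
    ∑ k, ∑ j, ((if k = i then 1 else 0) - (2 * n : ℝ)⁻¹) * θ.P k j = n * θ.α i := by
  have hn : (n : ℝ) ≠ 0 := Nat.cast_ne_zero.2 i.pos.ne'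
  simp_rw [← Finset.mul_sum, θ.sum_P_row hZ, sub_mul, Finset.sum_sub_distrib, ite_mul, one_mul,
    zero_mul, Finset.sum_ite_eq', ← Finset.mul_sum, Finset.sum_add_distrib, ← Finset.mul_sum]
  simp
  field_simp
  ring

/-- The weight of the edge `(k, j)`, `k < j`, in `√n α̂ᵢ`. -/
noncomputable def edgeWeight {n : ℕ} (i k j : Fin n) : ℝ :=
  (√(n : ℝ))⁻¹ * ((if k = i then 1 else 0) + (if j = i then 1 else 0) - (n : ℝ)⁻¹)

/-- The bias of `√n α̂ᵢ`, caused by the zero diagonal of the adjacency matrix. -/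
noncomputable def alphaHatBias {n : ℕ} (P : Matrix (Fin n) (Fin n) ℝ) (i : Fin n) : ℝ :=
  (√(n : ℝ))⁻¹ * ((2 * n : ℝ)⁻¹ * ∑ k, P k k - P i i)

theorem GFParams.isSymm_P {n p k₁ k₂ k₃ : ℕ} (θ : GFParams n p k₁ k₂ k₃) : θ.P.IsSymm := by
  ext k j
  simp [GFParams.P, mul_apply, mul_comm, add_comm]

theorem sqrt_mul_alphaHat_sub {n p k₁ k₂ k₃ : ℕ} (θ : GFParams n p k₁ k₂ k₃)
    (hZ : IsCentered θ.Z) {A : Matrix (Fin n) (Fin n) ℝ} (hA : A.IsSymm) (hA0 : ∀ k, A k k = 0)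
    (i : Fin n) :
    √(n : ℝ) * (alphaHat A i - θ.α i) =
      ∑ e : {e : Fin n × Fin n // e.1 < e.2},
        edgeWeight i e.1.1 e.1.2 * (A e.1.1 e.1.2 - θ.P e.1.1 e.1.2) + alphaHatBias θ.P i := by
  have hn : (0 : ℝ) < n := Nat.cast_pos.2 i.pos
  have hsq : √(n : ℝ) * (n : ℝ)⁻¹ = (√(n : ℝ))⁻¹ := by
    rw [← div_eq_mul_inv, Real.sqrt_div_self]
  have hα : θ.α i = (n : ℝ)⁻¹ * (n * θ.α i) := by field_simp
  rw [alphaHat_apply, hα, ← θ.sum_weighted_P hZ i, ← mul_sub, ← mul_assoc, hsq,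
    ← Finset.sum_sub_distrib]
  simp_rw [← Finset.sum_sub_distrib, ← mul_sub]
  rw [sum_sum_eq_sum_edges_add_sum_diag, mul_add, Finset.mul_sum]
  congr 1
  · refine Finset.sum_congr rfl fun e _ ↦ ?_
    rw [hA.apply, θ.isSymm_P.apply, edgeWeight]
    -- Each edge occurs in both orientations, so the correction `1 / (2n)` counts twice.
    have : (2 * n : ℝ)⁻¹ + (2 * n : ℝ)⁻¹ = (n : ℝ)⁻¹ := by field_simp; norm_num
    rw [← this]
    ring
  · simp only [alphaHatBias, hA0, zero_sub, mul_neg, sub_mul, Finset.sum_neg_distrib,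
      Finset.sum_sub_distrib, ite_mul, one_mul, zero_mul, Finset.sum_ite_eq', Finset.mem_univ,
      if_true, ← Finset.mul_sum]
    ring

theorem abs_alphaHatBias_le {n : ℕ} {P : Matrix (Fin n) (Fin n) ℝ}
    (hP : ∀ k j, P k j ∈ unitInterval) (i : Fin n) : |alphaHatBias P i| ≤ (√(n : ℝ))⁻¹ := by
  have hn : (0 : ℝ) < n := Nat.cast_pos.2 i.pos
  rw [alphaHatBias, abs_mul, abs_of_nonneg (by positivity)]
  refine mul_le_of_le_one_right (by positivity) ?_
  have h0 : 0 ≤ ∑ k, P k k := Finset.sum_nonneg fun k _ ↦ (hP k k).1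
  have h1 : ∑ k, P k k ≤ n := by
    simpa using Finset.sum_le_sum (s := Finset.univ) fun k _ ↦ (hP k k).2
  have h2 : (2 * n : ℝ)⁻¹ * ∑ k, P k k ≤ 1 := by
    rw [inv_mul_le_iff₀ (by positivity)]; linarith
  have h3 : 0 ≤ (2 * n : ℝ)⁻¹ * ∑ k, P k k := by positivity
  have := hP i i
  rw [abs_le]
  constructor <;> linarith [this.1, this.2]

theorem abs_edgeWeight_le {n : ℕ} (i : Fin n) {k j : Fin n} (hkj : k < j) :
    |edgeWeight i k j| ≤ (√(n : ℝ))⁻¹ := by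
  have hn : (1 : ℝ) ≤ n := Nat.one_le_cast.2 i.pos
  rw [edgeWeight, abs_mul, abs_of_nonneg (by positivity)]
  refine mul_le_of_le_one_right (by positivity) ?_
  have h1 : (n : ℝ)⁻¹ ≤ 1 := inv_le_one_of_one_le₀ hn
  have h0 : 0 ≤ (n : ℝ)⁻¹ := by positivity
  rw [abs_le]
  split_ifs with h h'
  -- Both indicators equal to one would mean a loop at `i`.
  · exact absurd (h.trans h'.symm) hkj.ne
  all_goals constructor <;> linarith

/-- The indicator `δ` of an edge at `i` satisfies `δ² = δ`, hence `(δ - 1/n)² = (1 - 2/n) δ + 1/n²`.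
-/
theorem sum_sq_edgeWeight_mul {n : ℕ} (i : Fin n) {v : Fin n → Fin n → ℝ}
    (hv : ∀ k j, v k j = v j k) :
    ∑ e : {e : Fin n × Fin n // e.1 < e.2}, edgeWeight i e.1.1 e.1.2 ^ 2 * v e.1.1 e.1.2 =
      (1 - 2 * (n : ℝ)⁻¹) * ((n : ℝ)⁻¹ * ∑ j ∈ Finset.univ.erase i, v i j) +
        (n : ℝ)⁻¹ ^ 3 * ∑ e : {e : Fin n × Fin n // e.1 < e.2}, v e.1.1 e.1.2 := by
  have h1 : ∑ j ∈ Finset.univ.erase i, v i j =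
      ∑ e : {e : Fin n × Fin n // e.1 < e.2},
        ((if e.1.1 = i then 1 else 0) + if e.1.2 = i then 1 else 0) * v e.1.1 e.1.2 := by
    -- Splitting the sum over row `i` isolates `v i i`, which is exactly the term erased on the
    -- left.
    have h := sum_sum_eq_sum_edges_add_sum_diag fun k j ↦ if k = i then v k j else 0
    simp only [Finset.sum_ite_eq', Finset.mem_univ, if_true] at h
    rw [Finset.sum_comm] at h
    simp only [Finset.sum_ite_eq', Finset.mem_univ, if_true] at h
    rw [← Finset.add_sum_erase _ _ (Finset.mem_univ i), add_comm, add_right_cancel_iff] at h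
    rw [h]
    refine Finset.sum_congr rfl fun e _ ↦ ?_
    rw [hv e.1.2 e.1.1, add_mul, ite_mul, ite_mul, one_mul, zero_mul]
  rw [h1, Finset.mul_sum, Finset.mul_sum, Finset.mul_sum, ← Finset.sum_add_distrib]
  refine Finset.sum_congr rfl fun e _ ↦ ?_
  have hw : (√(n : ℝ))⁻¹ ^ 2 = (n : ℝ)⁻¹ := by rw [inv_pow, Real.sq_sqrt (Nat.cast_nonneg n)]
  rw [edgeWeight, mul_pow, hw]
  split_ifs with h h'
  · exact absurd (h.trans h'.symm) e.2.ne
  all_goals ring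

theorem abs_sum_edges_le {n : ℕ} {v : Fin n → Fin n → ℝ} (hv : ∀ k j, |v k j| ≤ 1) :
    |∑ e : {e : Fin n × Fin n // e.1 < e.2}, v e.1.1 e.1.2| ≤ (n : ℝ) ^ 2 := by
  refine (Finset.abs_sum_le_sum_abs _ _).trans ?_
  refine (Finset.sum_le_card_nsmul _ _ 1 fun e _ ↦ hv _ _).trans ?_
  have : Fintype.card {e : Fin n × Fin n // e.1 < e.2} ≤ n ^ 2 := by
    simpa [sq] using Fintype.card_subtype_le fun e : Fin n × Fin n ↦ e.1 < e.2
  rw [Finset.card_univ, nsmul_one]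
  exact_mod_cast this

/-! ### Gaussian approximation and limiting variance -/

/-- The variance of the leading term of `√n α̂ᵢ` in a Bernoulli network with probabilities `P`. -/
noncomputable def alphaHatVariance {n : ℕ} (P : Matrix (Fin n) (Fin n) ℝ) (i : Fin n) : ℝ :=
  ∑ e : {e : Fin n × Fin n // e.1 < e.2},
    edgeWeight i e.1.1 e.1.2 ^ 2 * (P e.1.1 e.1.2 * (1 - P e.1.1 e.1.2))

theorem IsBernoulliNetwork.norm_charFun_sub_exp_le {n p k₁ k₂ k₃ : ℕ}
    {θ : GFParams n p k₁ k₂ k₃} (hZ : IsCentered θ.Z) {Ω : Type*} [MeasurableSpace Ω]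
    {μ : Measure Ω} [IsProbabilityMeasure μ] {A : Ω → Matrix (Fin n) (Fin n) ℝ}
    (hA : IsBernoulliNetwork μ A θ.P) (i : Fin n) (t : ℝ) (ht : |t| * (√(n : ℝ))⁻¹ ≤ 1) :
    ‖charFun (μ.map fun ω ↦ √(n : ℝ) * (alphaHat (A ω) i - θ.α i)) t -
        Complex.exp ((-(t ^ 2 * alphaHatVariance θ.P i) / 2 : ℝ)) *
          Complex.exp ((alphaHatBias θ.P i * t : ℝ) * Complex.I)‖ ≤
      |t| * (√(n : ℝ))⁻¹ * (t ^ 2 * alphaHatVariance θ.P i) := by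
  have hae : (fun ω ↦ √(n : ℝ) * (alphaHat (A ω) i - θ.α i)) =ᵐ[μ] fun ω ↦
      ∑ e : {e : Fin n × Fin n // e.1 < e.2},
        edgeWeight i e.1.1 e.1.2 * (A ω e.1.1 e.1.2 - θ.P e.1.1 e.1.2) + alphaHatBias θ.P i := by
    filter_upwards [hA.symm_zero_diag] with ω hω
    exact sqrt_mul_alphaHat_sub θ hZ hω.1 hω.2 i
  rw [Measure.map_congr hae, alphaHatVariance]
  have hc : ∀ e : {e : Fin n × Fin n // e.1 < e.2},
      |t * edgeWeight i e.1.1 e.1.2| ≤ |t| * (√(n : ℝ))⁻¹ := fun e ↦ by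
    rw [abs_mul]
    exact mul_le_mul_of_nonneg_left (abs_edgeWeight_le i e.2) (abs_nonneg t)
  have h := norm_charFun_bernoulli_sum_sub_exp_le
    (Y := fun (e : {e : Fin n × Fin n // e.1 < e.2}) ω ↦ A ω e.1.1 e.1.2)
    (q := fun e ↦ ⟨θ.P e.1.1 e.1.2, hA.mem_unit _ _⟩)
    hA.indep (fun e ↦ hA.law _ _ e.2) (fun e ↦ edgeWeight i e.1.1 e.1.2) (alphaHatBias θ.P i) t
    (|t| * (√(n : ℝ))⁻¹) ht hc
  exact h

/-- What remains is `n⁻³` times a sum of at most `n²` terms bounded by one. -/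
theorem abs_alphaHatVariance_sub_le {n d : ℕ} {X : Matrix (Fin n) (Fin d) ℝ}
    (hP : ∀ k j, (X * Xᵀ) k j ∈ unitInterval) (i : Fin n) :
    |alphaHatVariance (X * Xᵀ) i - (1 - 2 * (n : ℝ)⁻¹) * edgeVariance X i| ≤ (n : ℝ)⁻¹ := by
  have hn : (0 : ℝ) < n := Nat.cast_pos.2 i.pos
  have hX : ∀ k j, (X * Xᵀ) k j = X k ⬝ᵥ X j := fun k j ↦ by simp [mul_apply, dotProduct]
  rw [alphaHatVariance]
  simp_rw [hX]
  rw [sum_sq_edgeWeight_mul i (v := fun k j ↦ X k ⬝ᵥ X j * (1 - X k ⬝ᵥ X j))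
    fun k j ↦ by rw [dotProduct_comm], edgeVariance, add_sub_cancel_left, abs_mul,
    abs_of_nonneg (by positivity)]
  have h := abs_sum_edges_le (v := fun k j ↦ X k ⬝ᵥ X j * (1 - X k ⬝ᵥ X j)) fun k j ↦ by
    have := hP k j
    rw [hX] at this
    rw [abs_of_nonneg (mul_nonneg this.1 (sub_nonneg.2 this.2))]
    nlinarith [this.1, this.2]
  calc _ ≤ (n : ℝ)⁻¹ ^ 3 * (n : ℝ) ^ 2 := by gcongr
    _ = (n : ℝ)⁻¹ := by field_simp

theorem edgeVariance_nonneg {n d : ℕ} {X : Matrix (Fin n) (Fin d) ℝ}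
    (hP : ∀ k j, (X * Xᵀ) k j ∈ unitInterval) (i : Fin n) : 0 ≤ edgeVariance X i := by
  refine mul_nonneg (by positivity) (Finset.sum_nonneg fun j _ ↦ ?_)
  have h : (X * Xᵀ) i j = X i ⬝ᵥ X j := by simp [mul_apply, dotProduct]
  rw [← h]
  exact mul_nonneg (hP i j).1 (sub_nonneg.2 (hP i j).2)

theorem entry_of_lt {n i : ℕ} (v : Fin n → ℝ) (h : i < n) : entry v i = v ⟨i, h⟩ := dif_pos h

theorem measurable_entry_alphaHat {Ω : Type*} [MeasurableSpace Ω] {n : ℕ}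
    {A : Ω → Matrix (Fin n) (Fin n) ℝ} (hA : ∀ k j, Measurable fun ω ↦ A ω k j) (i : ℕ) :
    Measurable fun ω ↦ entry (alphaHat (A ω)) i := by
  by_cases h : i < n
  · simp_rw [entry_of_lt _ h, alphaHat_apply]
    fun_prop
  · simp [entry, h]

/-! ### Passage to the limit -/

/-- A sequence of laws whose characteristic functions are asymptotically those of `𝒩(bₙ, Sₙ)`,
with `bₙ → 0` and `Sₙ → Q`, has characteristic functions converging to that of `𝒩(0, Q)`. -/
theorem tendsto_charFun_gaussianReal_of_norm_sub_le {φ : ℕ → ℂ} {S b ε : ℕ → ℝ} {Q t : ℝ}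
    (hQ : 0 ≤ Q) (hS : Tendsto S atTop (𝓝 Q)) (hb : Tendsto b atTop (𝓝 0))
    (hε : Tendsto ε atTop (𝓝 0))
    (hφ : ∀ᶠ n in atTop, ‖φ n - Complex.exp ((-(t ^ 2 * S n) / 2 : ℝ)) *
      Complex.exp ((b n * t : ℝ) * Complex.I)‖ ≤ ε n * (t ^ 2 * S n)) :
    Tendsto φ atTop (𝓝 (charFun (gaussianReal 0 Q.toNNReal) t)) := by
  have h0 : Tendsto (fun n ↦ ε n * (t ^ 2 * S n)) atTop (𝓝 0) := by
    simpa using hε.mul (hS.const_mul (t ^ 2))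
  have h1 := squeeze_zero_norm' hφ h0
  have h2 : Tendsto (fun n ↦ Complex.exp ((-(t ^ 2 * S n) / 2 : ℝ)) *
      Complex.exp ((b n * t : ℝ) * Complex.I)) atTop
      (𝓝 (charFun (gaussianReal 0 Q.toNNReal) t)) := by
    have hc : Continuous fun x : ℝ × ℝ ↦ Complex.exp ((-(t ^ 2 * x.1) / 2 : ℝ)) *
        Complex.exp ((x.2 * t : ℝ) * Complex.I) := by fun_prop
    have h := (hc.tendsto (Q, 0)).comp (hS.prodMk_nhds hb)
    have e : charFun (gaussianReal 0 Q.toNNReal) t =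
        Complex.exp ((-(t ^ 2 * Q) / 2 : ℝ)) * Complex.exp ((0 * t : ℝ) * Complex.I) := by
      rw [charFun_gaussianReal]
      have hq : ((Q.toNNReal : ℝ) : ℂ) = Q := by rw [Real.coe_toNNReal _ hQ]
      simp only [hq, zero_mul, Complex.ofReal_zero, Complex.exp_zero, mul_one, mul_zero]
      congr 1
      push_cast
      ring
    rw [e]
    exact h
  simpa using h1.add h2

theorem theorem3 {k₁ k₂ k₃ d : ℕ} (p : ℕ → ℕ)
    -- for every `n`: parameters, a probability space and a random matrix `A n`
    (θ : ∀ n, GFParams n (p n) k₁ k₂ k₃)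
    {Ω : ℕ → Type*} [∀ n, MeasurableSpace (Ω n)]
    (μ : ∀ n, Measure (Ω n)) [∀ n, IsProbabilityMeasure (μ n)]
    (A : ∀ n, Ω n → Matrix (Fin n) (Fin n) ℝ)
    (hAmeas : ∀ n i j, Measurable fun ω ↦ A n ω i j)
    -- the network model (symmetric adjacency matrix with zero diagonal)
    (hA : ∀ᶠ n in atTop, IsBernoulliNetwork (μ n) (A n) (θ n).P)
    -- `P` is positive semidefinite, and the largest expected degree is not too small
    (hPsd : ∀ᶠ n in atTop, (θ n).P.PosSemidef)
    (hdeg : ∃ a : ℝ, 0 < a ∧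
      ∀ᶠ n : ℕ in atTop, ∃ i, Real.log (n : ℝ) ^ (4 + a) < ∑ j, (θ n).P i j)
    -- boundedness of the factor model parameters
    (hbdd : ∃ C : ℝ, 0 < C ∧
      (∀ᶠ n in atTop, ∀ j, 0 < (θ n).Ψ j ∧ (θ n).Ψ j ≤ C ∧
        ‖WithLp.toLp 2 ((θ n).Λ j)‖ ≤ C) ∧
      ∀ MZ, Tendsto (fun n : ℕ ↦ (n : ℝ)⁻¹ • ((θ n).Zᵀ * (θ n).Z)) atTop (𝓝 MZ) →
        ∀ a b, |MZ a b| ≤ C)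
    -- identifiability
    (hident : ∀ᶠ n in atTop, (θ n).Ident1 ∨ (θ n).Ident2 ∨ (θ n).Ident3)
    -- `P = X Xᵀ`, and the existence of the limits
    (X : ∀ n, Matrix (Fin n) (Fin d) ℝ) (hX : ∀ᶠ n in atTop, (θ n).P = X n * (X n)ᵀ)
    (MX : Matrix (Fin d) (Fin d) ℝ)
    (hMX : Tendsto (fun n : ℕ ↦ (n : ℝ)⁻¹ • ((X n)ᵀ * X n)) atTop (𝓝 MX))
    (i : ℕ) (Q : ℝ) (hQ : Tendsto (fun n ↦ entry (edgeVariance (X n)) i) atTop (𝓝 Q)) :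
    0 ≤ Q ∧
    TendstoInDistribution
      (fun (n : ℕ) ω ↦ √(n : ℝ) * (entry (alphaHat (A n ω)) i - entry (θ n).α i)) atTop
      (id : ℝ → ℝ) μ (gaussianReal 0 Q.toNNReal) := by
  have hcent : ∀ᶠ n in atTop, IsCentered (θ n).Z := by
    filter_upwards [hident] with n hn
    rcases hn with h | h | h <;> exact h.1
  have hmem : ∀ᶠ n in atTop, ∀ k j, (X n * (X n)ᵀ) k j ∈ unitInterval := by
    filter_upwards [hA, hX] with n hn hXn
    exact hXn ▸ hn.mem_unit
  have hQ0 : 0 ≤ Q := by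
    refine ge_of_tendsto hQ ?_
    -- Once `n > i`, the default value in `entry` plays no role.
    filter_upwards [hmem, eventually_gt_atTop i] with n hn hin
    rw [entry_of_lt _ hin]
    exact edgeVariance_nonneg hn _
  have hinv : Tendsto (fun n : ℕ ↦ (n : ℝ)⁻¹) atTop (𝓝 0) := tendsto_inv_atTop_nhds_zero_nat
  have hsqrt : Tendsto (fun n : ℕ ↦ (√(n : ℝ))⁻¹) atTop (𝓝 0) :=
    tendsto_inv_atTop_zero.comp (Real.tendsto_sqrt_atTop.comp tendsto_natCast_atTop_atTop)
  have hb : Tendsto (fun n ↦ entry (alphaHatBias (θ n).P) i) atTop (𝓝 0) := by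
    refine squeeze_zero_norm' ?_ hsqrt
    filter_upwards [hA, eventually_gt_atTop i] with n hn hin
    rw [entry_of_lt _ hin]
    exact abs_alphaHatBias_le hn.mem_unit _
  have hS : Tendsto (fun n ↦ entry (alphaHatVariance (θ n).P) i) atTop (𝓝 Q) := by
    have h1 : Tendsto (fun n : ℕ ↦ (1 - 2 * (n : ℝ)⁻¹) * entry (edgeVariance (X n)) i) atTop
        (𝓝 Q) := by
      simpa using ((hinv.const_mul 2).const_sub 1).mul hQ
    have h2 : Tendsto (fun n : ℕ ↦ entry (alphaHatVariance (θ n).P) i -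
        (1 - 2 * (n : ℝ)⁻¹) * entry (edgeVariance (X n)) i) atTop (𝓝 0) := by
      refine squeeze_zero_norm' ?_ hinv
      filter_upwards [hmem, hX, eventually_gt_atTop i] with n hn hXn hin
      rw [entry_of_lt _ hin, entry_of_lt _ hin, hXn]
      exact abs_alphaHatVariance_sub_le hn _
    simpa using h2.add h1
  have hmeas : ∀ n : ℕ, Measurable fun ω ↦
      √(n : ℝ) * (entry (alphaHat (A n ω)) i - entry (θ n).α i) := fun n ↦
    ((measurable_entry_alphaHat (hAmeas n) i).sub_const _).const_mul _
  refine ⟨hQ0, fun n ↦ (hmeas n).aemeasurable, aemeasurable_id, ?_⟩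
  -- Lévy's continuity theorem: it suffices to fix `t`, and then `|t| / √n ≤ 1` holds eventually, as
  -- the Taylor bounds require.
  refine ProbabilityMeasure.tendsto_of_tendsto_charFun fun t ↦ ?_
  have hε : Tendsto (fun n : ℕ ↦ |t| * (√(n : ℝ))⁻¹) atTop (𝓝 0) := by
    simpa using hsqrt.const_mul |t|
  simp only [ProbabilityMeasure.coe_mk, Measure.map_id]
  refine tendsto_charFun_gaussianReal_of_norm_sub_le hQ0 hS hb hε ?_
  filter_upwards [hA, hcent, eventually_gt_atTop i, hε.eventually_le_const one_pos]
    with n hn hZ hin ht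
  simp only [entry_of_lt _ hin]
  exact hn.norm_charFun_sub_exp_le hZ ⟨i, hin⟩ t ht
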